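/- **Setting.** Let $f:\mathbb R^n\to\mathbb R^n$, $g:\mathbb R^n\to\mathbb R^{n\times m}$, $f_c:\mathbb R^{n_c}\to\mathbb R^{n_c}$, $g_c:\mathbb R^{n_c}\to\mathbb R^{n_c\times m}$ and $h_c:\mathbb R^{n_c}\to\mathbb R^m$ be locally Lipschitz, let $h_1,\dots,h_\ell:\mathbb R^n\to\mathbb R$ and $\phi_1,\dots,\phi_{\ell_u}:\mathbb R^m\to\mathbb R$ be continuously differentiable, and put $S_s=\{x: h_j(x)\ge 0\ \forall j\}$, $\mathcal U=\{u:\phi_\kappa(u)\ge0\ \forall\kappa\}$, $S_c=\{x_c: h_c(x_c)\in\mathcal U\}$. For a differentiable $\eta$ and a vector field or matrix of vector fields $\psi$, $L_\psi\eta(x)=\eta'(x)\psi(x)$. All derivatives written below are assumed to exist and to be continuous. Assume that there are positive integers $d_1,\dots,d_\ell,d_c,\zeta$ such that: * (A1) for all $j$: $L_gL_f^ih_j=0$ on $\mathbb R^n$ for $0\le i\le d_j-2$, and $L_gL_f^{d_j-1}h_j(x)\ne0$ for all $x\in S_s$; * (C1) $L_{g_c}L_{f_c}^ih_c=0$ on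 $\mathbb R^{n_c}$ for $0\le i\le d_c-2$, and $L_{g_c}L_{f_c}^{d_c-1}h_c(x_c)$ is nonsingular for all $x_c\in\mathbb R^{n_c}$; * (C2) for all $\kappa$: $L_{g_c}L_{f_c}^i(\phi_\kappa\circ h_c)=0$ on $\mathbb R^{n_c}$ for $0\le i\le\zeta-2$, and $L_{g_c}L_{f_c}^{\zeta-1}(\phi_\kappa\circ h_c)(x_c)\ne0$ for all $x_c\in S_c$. Consider the cascade $\dot{\hat x}=\hat f(\hat x)+\hat g(\hat x)\hat u$ with state $\hat x=(x,x_c)\in\mathbb R^{n+n_c}$, input $\hat u\in\mathbb R^m$ and $$\hat f(\hat x)=\begin{bmatrix}f(x)+g(x)h_c(x_c)\\ f_c(x_c)\end{bmatrix},\qquad \hat g(\hat x)=\begin{bmatrix}0\\ g_c(x_c)\end{bmatrix}.$$ For $1\le j\le\ell$ let $\hat h_j(\hat x)=h_j(x)$ and $\hat d_j=d_j+d_c$; for $\ell+1\le j\le\hat\ell=\ell+\ell_u$ let $\hat h_j(\hat x)=\phi_{j-\ell}(h_c(x_c))$ and $\hat d_j=\zeta$. For $0\le i\le\hat d_j-2$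 let $\hat\alpha_{j,i}:\mathbb R\to\mathbb R$ be locally Lipschitz, strictly increasing, with $\hat\alpha_{j,i}(0)=0$. Let $\hat b_{j,0}=\hat h_j$ and $\hat b_{j,i+1}=L_{\hat f}\hat b_{j,i}+\hat\alpha_{j,i}\circ\hat b_{j,i}$. Let $\hat C_j=\{\hat b_{j,0}\ge0\}$ if $\hat d_j=1$, $\hat C_j=\bigcap_{i=0}^{\hat d_j-2}\{\hat b_{j,i}\ge0\}$ if $\hat d_j>1$, and $\hat C=\bigcap_{j=1}^{\hat\ell}\hat C_j$. Let $\rho>0$ and $$\hat h(\hat x)=-\frac1\rho\log\sum_{j=1}^{\hat\ell}e^{-\rho\,\hat b_{j,\hat d_j-1}(\hat x)},\quad \hat H=\{\hat h\ge0\},\quad \hat S=\hat H\cap\hat C,\quad \hat B=\{\hat x\in\operatorname{bd}\hat H: L_{\hat f}\hat h(\hat x)\le0\}.$$ A closed set $D$ of cascade states is *control forward invariant* if there is a locally Lipschitz feedback $\hat u$ on $D$ (equivalently, the restriction to $D$ of a locally Lipschitz feedback on $\mathbb R^{n+n_c}$) such that every solution of the closed loop that starts in $D$ stays in $D$ on its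 whole forward interval of existence. **Corollary.** Assume that $\hat h'$ is locally Lipschitz on $\hat H$ and that $L_{\hat g}\hat h(\hat x)\neq0$ for all $\hat x\in\hat B$. Then $\hat S$ is control forward invariant with respect to the cascade. -/

import Mathlib

namespace SoftMinCBF

section General

variable {X U F : Type*} [NormedAddCommGroup X] [NormedSpace ℝ X]
  [NormedAddCommGroup U] [NormedSpace ℝ U] [NormedAddCommGroup F] [NormedSpace ℝ F]

/-- The Lie derivative `L_f η (x) = η'(x) f(x)` along a vector field `f`. Iterated Lie derivatives
`L_f^i η` are written `(lieD f)^[i] η`. -/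
noncomputable def lieD (f : X → X) (η : X → F) : X → F :=
  fun x => fderiv ℝ η x (f x)

/-- The Lie derivative `L_g η (x) = η'(x) g(x)` along the columns of `g`, where the matrix `g x` is
regarded as a linear map from the input space to the state space. -/
noncomputable def lieG (g : X → U →L[ℝ] X) (η : X → F) : X → U →L[ℝ] F :=
  fun x => (fderiv ℝ η x).comp (g x)

/-- `x` is a solution on `[0, T)` of `x' = f x + g x (u x)`, `x 0 = x₀` (at `t = 0` the derivative
is one-sided). -/
def IsSolution (f : X → X) (g : X → U →L[ℝ] X) (u : X → U) (x₀ : X) (T : ℝ) (x : ℝ → X) : Prop :=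
  x 0 = x₀ ∧ ∀ t ∈ Set.Ico 0 T, HasDerivWithinAt x (f (x t) + g (x t) (u (x t))) (Set.Ici 0) t

/-- `D` is control forward invariant for `x' = f x + g x u`: there is a locally Lipschitz feedback
`u` under which every solution that starts in `D` remains in `D` as long as it exists. So that the
closed loop is a differential equation on the whole state space, `u` is locally Lipschitz on the
whole state space; only its values on `D` matter, and for closed `D` every locally Lipschitz
feedback on `D` has such an extension. -/
def ControlForwardInvariant (f : X → X) (g : X → U →L[ℝ] X) (D : Set X) : Prop :=
  ∃ u : X → U, LocallyLipschitz u ∧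
    ∀ x₀ ∈ D, ∀ (T : ℝ) (x : ℝ → X), IsSolution f g u x₀ T x → ∀ t ∈ Set.Ico 0 T, x t ∈ D

/-- Extended class-K functions. -/
def IsExtendedClassK (a : ℝ → ℝ) : Prop :=
  Continuous a ∧ StrictMono a ∧ a 0 = 0

/-- The log-sum-exp soft minimum. -/
noncomputable def softmin {ι : Type*} [Fintype ι] (ρ : ℝ) (z : ι → ℝ) : ℝ :=
  -(1 / ρ) * Real.log (∑ i, Real.exp (-ρ * z i))

/-- The set on which all functions of a family are nonnegative. -/
def safeSet {ι : Type*} (h : ι → X → ℝ) : Set X :=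
  {x | ∀ j, 0 ≤ h j x}

/-- `b 0 = η`, `b (i + 1) = L_f (b i) + α i ∘ b i`. -/
noncomputable def bSeq (f : X → X) (α : ℕ → ℝ → ℝ) (η : X → ℝ) : ℕ → X → ℝ
  | 0 => η
  | i + 1 => fun x => lieD f (bSeq f α η i) x + α i (bSeq f α η i x)

variable {ι : Type*} (f : X → X) (g : X → U →L[ℝ] X) (h : ι → X → ℝ) (d : ι → ℕ)
  (α : ι → ℕ → ℝ → ℝ) (ρ : ℝ)

/-- The set `C_j`: the `b_{j,i}`, `0 ≤ i ≤ d_j - 2`, are nonnegative; and `b_{j,0} ≥ 0`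
if `d_j = 1`. -/
def setCj (j : ι) : Set X :=
  if d j = 1 then {x | 0 ≤ bSeq f (α j) (h j) 0 x}
  else {x | ∀ i, i + 2 ≤ d j → 0 ≤ bSeq f (α j) (h j) i x}

/-- The intersection of all `C_j`. -/
def setC : Set X := ⋂ j, setCj f h d α j

/-- The composite function `softmin_ρ (b_{1, d_1 - 1}, …, b_{ℓ, d_ℓ - 1})`. -/
noncomputable def composite [Fintype ι] : X → ℝ :=
  fun x => softmin ρ (fun j => bSeq f (α j) (h j) (d j - 1) x)

/-- The zero-superlevel set of the composite function. -/
def setH [Fintype ι] : Set X := {x | 0 ≤ composite f h d α ρ x}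

/-- The intersection of `setH` and `setC`. -/
def setS [Fintype ι] : Set X := setH f h d α ρ ∩ setC f h d α

/-- The boundary points of `setH` where the Lie derivative of the composite function along `f`
is nonpositive. -/
def setB [Fintype ι] : Set X :=
  {x ∈ frontier (setH f h d α ρ) | lieD f (composite f h d α ρ) x ≤ 0}

/-- Condition A1 on the plant: for every `j`, `d_j` is positive, `L_g L_f^i h_j = 0` everywhere for
`0 ≤ i ≤ d_j - 2`, and `L_g L_f^(d_j - 1) h_j ≠ 0` on the safe set. The first clause after
positivity says that the derivatives written here exist and are continuous. -/
def CondA1 : Prop :=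
  ∀ j, 0 < d j ∧
    (∀ i, i < d j → ContDiff ℝ 1 ((lieD f)^[i] (h j))) ∧
    (∀ x, ∀ i, i + 2 ≤ d j → lieG g ((lieD f)^[i] (h j)) x = 0) ∧
    (∀ x ∈ safeSet h, lieG g ((lieD f)^[d j - 1] (h j)) x ≠ 0)

end General

section Cascade

variable {E Ec U : Type*} [NormedAddCommGroup E] [NormedSpace ℝ E]
  [NormedAddCommGroup Ec] [NormedSpace ℝ Ec] [NormedAddCommGroup U] [NormedSpace ℝ U]

/-- Condition C1 on the control dynamics: `d_c` is positive, `L_{g_c} L_{f_c}^i h_c = 0` for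
`0 ≤ i ≤ d_c - 2`, and `L_{g_c} L_{f_c}^(d_c - 1) h_c` is nonsingular, everywhere; the derivatives
written here exist and are continuous. -/
def CondC1 (fc : Ec → Ec) (gc : Ec → U →L[ℝ] Ec) (hc : Ec → U) (dc : ℕ) : Prop :=
  0 < dc ∧
    (∀ i, i < dc → ContDiff ℝ 1 ((lieD fc)^[i] hc)) ∧
    (∀ xc, ∀ i, i + 2 ≤ dc → lieG gc ((lieD fc)^[i] hc) xc = 0) ∧
    (∀ xc, IsUnit (lieG gc ((lieD fc)^[dc - 1] hc) xc))

/-- Condition C2 on the control dynamics: `ζ` is positive and for every `κ`,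
`L_{g_c} L_{f_c}^i (φ_κ ∘ h_c) = 0` everywhere for `0 ≤ i ≤ ζ - 2`, and
`L_{g_c} L_{f_c}^(ζ - 1) (φ_κ ∘ h_c) ≠ 0` at every controller state whose output is an admissible
control; the derivatives written here exist and are continuous. -/
def CondC2 {ι' : Type*} (fc : Ec → Ec) (gc : Ec → U →L[ℝ] Ec) (hc : Ec → U) (φ : ι' → U → ℝ)
    (ζ : ℕ) : Prop :=
  0 < ζ ∧ ∀ κ,
    (∀ i, i < ζ → ContDiff ℝ 1 ((lieD fc)^[i] (φ κ ∘ hc))) ∧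
    (∀ xc, ∀ i, i + 2 ≤ ζ → lieG gc ((lieD fc)^[i] (φ κ ∘ hc)) xc = 0) ∧
    (∀ xc, hc xc ∈ safeSet φ → lieG gc ((lieD fc)^[ζ - 1] (φ κ ∘ hc)) xc ≠ 0)

/-- The drift of the cascade: `(f x + g x (h_c x_c), f_c x_c)`. -/
def cascadeDrift (f : E → E) (g : E → U →L[ℝ] E) (fc : Ec → Ec) (hc : Ec → U) :
    E × Ec → E × Ec :=
  fun p => (f p.1 + g p.1 (hc p.2), fc p.2)

/-- The input matrix of the cascade: `(0, g_c x_c)`. -/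
noncomputable def cascadeInput (E : Type*) [NormedAddCommGroup E] [NormedSpace ℝ E]
    (gc : Ec → U →L[ℝ] Ec) : E × Ec → U →L[ℝ] E × Ec :=
  fun p => (ContinuousLinearMap.inr ℝ E Ec).comp (gc p.2)

/-- The constraint functions of the cascade: the `h_j x`, followed by the `φ_κ (h_c x_c)`. -/
def cascadeConstraint {ι ι' : Type*} (h : ι → E → ℝ) (φ : ι' → U → ℝ) (hc : Ec → U) :
    ι ⊕ ι' → E × Ec → ℝ :=
  Sum.elim (fun j p => h j p.1) (fun κ p => φ κ (hc p.2))

/-- The relative degrees for the cascade: `d_j + d_c` for the `h_j` and `ζ` for the `φ_κ ∘ h_c`. -/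
def cascadeDegree {ι : Type*} (ι' : Type*) (d : ι → ℕ) (dc ζ : ℕ) : ι ⊕ ι' → ℕ :=
  Sum.elim (fun j => d j + dc) (fun _ => ζ)

end Cascade

end SoftMinCBF

/-!
The point is that `L_ĝ b̂_{j,i} = 0` for `i ≤ d̂_j - 2`. The data are only locally Lipschitz, so
`L_f̂^i ĥ_j` need not exist for `i ≥ d_j` and relative degrees cannot be added by composing Lie
derivatives. Instead, compare the solutions that start at one point under a constant input `v` and
under the zero input. Each order at which an output has vanishing input derivative gains a power of
`t` by integration, and so does passing from the controller output `h_c` to the plant state `x`, by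
Grönwall's inequality. Hence the two values of `ĥ_j` differ by `o(t ^ (d̂_j - 1))`. If, on the other
hand, `b̂_{j,i}` were the first member of the chain with `L_ĝ b̂_{j,i} v = c ≠ 0`, then integrating
the recursion `i + 1` times would give that difference the leading term
`c t ^ (i + 1) / (i + 1)!`, a contradiction.

For the invariance, a partition of unity glues constant inputs to a smooth feedback under which `ĥ`
increases at the boundary of `Ĥ`, so `Ĥ` is invariant. There all `b̂_{j,d̂_j-1}` are nonnegative, as
they dominate the soft minimum, and since the input does not enter the derivatives of the earlier
`b̂_{j,i}`, the relation `(b̂_{j,i})' = b̂_{j,i+1} - α̂_{j,i}(b̂_{j,i})` makes them nonnegative by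
descending induction on `i`.
-/

namespace SoftMinCBF

open Set Filter Topology Asymptotics
open scoped NNReal Manifold

section Asymptotics

open scoped Nat

variable {Y Z : Type*} [NormedAddCommGroup Y] [NormedAddCommGroup Z]

lemma gronwallBound_zero_le {K ε t : ℝ} (hK : 0 < K) (hε : 0 ≤ ε) (ht : 0 ≤ t) (hKt : K * t ≤ 1) :
    gronwallBound 0 K ε t ≤ 2 * ε * t := by
  have hKt0 : 0 ≤ K * t := by positivity
  have hexp : Real.exp (K * t) - 1 ≤ 2 * (K * t) := by
    simpa [abs_of_nonneg hKt0] using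
      (le_abs_self _).trans (Real.abs_exp_sub_one_le ((abs_of_nonneg hKt0).trans_le hKt))
  calc gronwallBound 0 K ε t = ε / K * (Real.exp (K * t) - 1) := by
        simp [gronwallBound_of_K_ne_0 hK.ne']
    _ ≤ ε / K * (2 * (K * t)) := by gcongr
    _ = 2 * ε * t := by field_simp

lemma isLittleO_pow_succ_of_norm_deriv_le [NormedSpace ℝ Y] {e e' : ℝ → Y} {r : ℝ → Z}
    {L : ℝ} {m : ℕ} (h0 : e 0 = 0) (hderiv : ∀ᶠ t in 𝓝[≥] 0, HasDerivWithinAt e (e' t) (Ici 0) t)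
    (hbound : ∀ᶠ t in 𝓝[≥] 0, ‖e' t‖ ≤ L * ‖e t‖ + ‖r t‖)
    (hr : r =o[𝓝[≥] 0] fun t => t ^ m) :
    e =o[𝓝[≥] 0] fun t => t ^ (m + 1) := by
  refine isLittleO_iff.mpr fun c hc => ?_
  set K : ℝ := |L| + 1
  have hK : 0 < K := by positivity
  obtain ⟨δ, hδ, hnear⟩ := mem_nhdsGE_iff_exists_Ico_subset.mp
    (hderiv.and (hbound.and (isLittleO_iff.mp hr (half_pos hc))))
  have hδK : 0 < min δ (1 / K) := lt_min hδ (by positivity)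
  filter_upwards [Ico_mem_nhdsGE hδK] with t ⟨ht0, htlt⟩
  obtain ⟨htδ, htK⟩ := lt_min_iff.mp htlt
  have hsub : ∀ {s}, s ∈ Icc 0 t → s ∈ Ico 0 δ := fun hs => ⟨hs.1, hs.2.trans_lt htδ⟩
  have hforcing : ∀ s ∈ Ico 0 t, ‖e' s‖ ≤ K * ‖e s‖ + c / 2 * t ^ m := fun s hs => by
    obtain ⟨-, hLs, hrs⟩ := hnear (hsub (Ico_subset_Icc_self hs))
    have hpow : ‖s ^ m‖ ≤ t ^ m := by
      rw [Real.norm_of_nonneg (pow_nonneg hs.1 m)]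
      exact pow_le_pow_left₀ hs.1 hs.2.le m
    have hLK : L ≤ K := (le_abs_self L).trans (by simp [K])
    calc ‖e' s‖ ≤ L * ‖e s‖ + ‖r s‖ := hLs
      _ ≤ K * ‖e s‖ + c / 2 * t ^ m := by
        gcongr
        exact hrs.trans (by gcongr)
  have hgronwall := norm_le_gronwallBound_of_norm_deriv_right_le (δ := 0)
    (fun s hs => ((hnear (hsub hs)).1.continuousWithinAt).mono Icc_subset_Ici_self)
    (fun s hs => (hnear (hsub (Ico_subset_Icc_self hs))).1.mono (Ici_subset_Ici.mpr hs.1))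
    (by simp [h0]) hforcing t (right_mem_Icc.mpr ht0)
  calc ‖e t‖ ≤ gronwallBound 0 K (c / 2 * t ^ m) (t - 0) := hgronwall
    _ ≤ 2 * (c / 2 * t ^ m) * (t - 0) :=
      gronwallBound_zero_le hK (by positivity) (by simpa) (by
        simpa using ((lt_div_iff₀' hK).mp htK).le)
    _ = c * t ^ (m + 1) := by ring
    _ = c * ‖t ^ (m + 1)‖ := by rw [Real.norm_of_nonneg (by positivity)]

lemma eventually_norm_comp_sub_le {a : Y → Z} {x y : ℝ → Y} (ha : LocallyLipschitz a)
    (hx : ContinuousWithinAt x (Ici 0) 0) (hy : ContinuousWithinAt y (Ici 0) 0)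
    (h0 : x 0 = y 0) :
    ∃ L : ℝ≥0, ∀ᶠ t in 𝓝[≥] 0, ‖a (x t) - a (y t)‖ ≤ L * ‖x t - y t‖ := by
  obtain ⟨L, s, hs, hL⟩ := ha (x 0)
  refine ⟨L, ?_⟩
  filter_upwards [hx hs, hy (h0 ▸ hs)] with t hxt hyt using hL.norm_sub_le hxt hyt

variable [NormedSpace ℝ Y]

lemma hasDerivAt_pow_succ_div_factorial (n : ℕ) (t : ℝ) :
    HasDerivAt (fun s : ℝ => s ^ (n + 1) / (n + 1)!) (t ^ n / n !) t := by
  refine ((hasDerivAt_pow (n + 1) t).div_const ((n + 1)! : ℝ)).congr_deriv ?_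
  rw [Nat.factorial_succ]
  push_cast
  field_simp

lemma isLittleO_pow_succ_div_smul (n : ℕ) (k : ℝ) (c : Y) :
    (fun t : ℝ => (t ^ (n + 1) / k) • c) =o[𝓝[≥] 0] fun t => t ^ n := by
  have hpow : (fun t : ℝ => t ^ (n + 1)) =o[𝓝[≥] 0] fun t => t ^ n :=
    (isLittleO_pow_pow n.lt_succ_self).mono nhdsWithin_le_nhds
  refine (IsBigO.of_bound (‖c‖ / ‖k‖) (Eventually.of_forall fun t => ?_)).trans_isLittleO hpow
  rw [norm_smul, norm_div]
  exact le_of_eq (by ring)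

lemma chain_sub_isLittleO {N : ℕ} {a : ℕ → Y → Y} {B B' : ℕ → ℝ → Y} {c : Y}
    (ha : ∀ k < N, LocallyLipschitz (a k)) (h0 : ∀ k ≤ N, B k 0 = B' k 0)
    (hB : ∀ k < N, ∀ᶠ t in 𝓝[≥] 0, HasDerivWithinAt (B k) (B (k + 1) t - a k (B k t)) (Ici 0) t)
    (hB' : ∀ k < N, ∀ᶠ t in 𝓝[≥] 0,
      HasDerivWithinAt (B' k) (B' (k + 1) t - a k (B' k t)) (Ici 0) t)
    (hN : HasDerivWithinAt (fun t => B N t - B' N t) c (Ici 0) 0) :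
    (fun t => B 0 t - B' 0 t - (t ^ (N + 1) / (N + 1)!) • c) =o[𝓝[≥] 0] fun t => t ^ (N + 1) := by
  induction N generalizing a B B' with
  | zero => simpa [h0, hasDerivWithinAt_iff_isLittleO] using hN
  | succ N ih =>
    have htail := ih (a := fun k => a (k + 1)) (B := fun k => B (k + 1)) (B' := fun k => B' (k + 1))
      (fun k hk => ha _ (by omega)) (fun k hk => h0 _ (by omega)) (fun k hk => hB _ (by omega))
      (fun k hk => hB' _ (by omega)) hN
    have hB0 := hB 0 N.succ_pos
    have hB0' := hB' 0 N.succ_pos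
    obtain ⟨L, hL⟩ := eventually_norm_comp_sub_le (ha 0 N.succ_pos)
      (hB0.self_of_nhdsWithin self_mem_Ici).continuousWithinAt
      (hB0'.self_of_nhdsWithin self_mem_Ici).continuousWithinAt (h0 0 (Nat.zero_le _))
    set q : ℝ → Y := fun t => (t ^ (N + 2) / (N + 2)!) • c
    have hq : q =o[𝓝[≥] 0] fun t => t ^ (N + 1) := isLittleO_pow_succ_div_smul _ _ c
    refine isLittleO_pow_succ_of_norm_deriv_le (L := L) (by simp [h0])
      (by filter_upwards [hB0, hB0'] with t ht ht'
          using (ht.fun_sub ht').fun_sub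
            ((hasDerivAt_pow_succ_div_factorial (N + 1) t).smul_const c).hasDerivWithinAt)
      ?_ (htail.norm_left.add (hq.norm_left.const_mul_left L))
    filter_upwards [hL] with t ht
    set D : Y := B 1 t - B' 1 t - (t ^ (N + 1) / (N + 1)!) • c
    have hΔ : ‖B 0 t - B' 0 t‖ ≤ ‖B 0 t - B' 0 t - q t‖ + ‖q t‖ := by
      simpa using norm_add_le (B 0 t - B' 0 t - q t) (q t)
    calc _ = ‖D - (a 0 (B 0 t) - a 0 (B' 0 t))‖ := by
          congr 1
          simp only [D, zero_add]
          abel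
      _ ≤ ‖D‖ + L * (‖B 0 t - B' 0 t - q t‖ + ‖q t‖) :=
        (norm_sub_le _ _).trans (by gcongr; exact ht.trans (by gcongr))
      _ = L * ‖B 0 t - B' 0 t - q t‖ + (‖D‖ + L * ‖q t‖) := by ring
      _ = _ := by
        rw [Real.norm_of_nonneg (r := ‖_‖ + _) (by positivity)]

lemma eq_zero_of_chain_sub_isLittleO {N : ℕ} {a : ℕ → Y → Y} {B B' : ℕ → ℝ → Y} {c : Y}
    (ha : ∀ k < N, LocallyLipschitz (a k)) (h0 : ∀ k ≤ N, B k 0 = B' k 0)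
    (hB : ∀ k < N, ∀ᶠ t in 𝓝[≥] 0, HasDerivWithinAt (B k) (B (k + 1) t - a k (B k t)) (Ici 0) t)
    (hB' : ∀ k < N, ∀ᶠ t in 𝓝[≥] 0,
      HasDerivWithinAt (B' k) (B' (k + 1) t - a k (B' k t)) (Ici 0) t)
    (hN : HasDerivWithinAt (fun t => B N t - B' N t) c (Ici 0) 0)
    (hflat : (fun t => B 0 t - B' 0 t) =o[𝓝[≥] 0] fun t => t ^ (N + 1)) : c = 0 := by
  have hleading : (fun t : ℝ => t ^ (N + 1) • (((N + 1)! : ℝ)⁻¹ • c)) =o[𝓝[>] 0]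
      fun t => t ^ (N + 1) := by
    refine ((hflat.sub (chain_sub_isLittleO ha h0 hB hB' hN)).mono
      (nhdsWithin_mono 0 Ioi_subset_Ici_self)).congr_left fun t => ?_
    rw [sub_sub_cancel, smul_smul, div_eq_mul_inv]
  have hconst : (fun _ : ℝ => ((N + 1)! : ℝ)⁻¹ • c) =o[𝓝[>] 0] fun _ => (1 : ℝ) := by
    refine ((isBigO_refl (fun t : ℝ => (t ^ (N + 1))⁻¹) _).smul_isLittleO hleading).congr' ?_ ?_ <;>
      filter_upwards [self_mem_nhdsWithin] with t (ht : 0 < t)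
    · rw [inv_smul_smul₀ (by positivity)]
    · simp [ht.ne']
  simpa [Nat.factorial_ne_zero] using hconst

end Asymptotics

section Solutions

variable {X U Y : Type*} [NormedAddCommGroup X] [NormedSpace ℝ X]
  [NormedAddCommGroup U] [NormedSpace ℝ U] [NormedAddCommGroup Y] [NormedSpace ℝ Y]
  {f : X → X} {g : X → U →L[ℝ] X} {u : X → U} {p : X} {T : ℝ} {x : ℝ → X}

lemma IsSolution.mono (hx : IsSolution f g u p T x) {T' : ℝ} (hT : T' ≤ T) :
    IsSolution f g u p T' x :=
  ⟨hx.1, fun t ht => hx.2 t ⟨ht.1, ht.2.trans_le hT⟩⟩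

lemma IsSolution.continuousWithinAt (hx : IsSolution f g u p T x) {t : ℝ} (ht : t ∈ Ico 0 T) :
    ContinuousWithinAt x (Ici 0) t :=
  (hx.2 t ht).continuousWithinAt

lemma IsSolution.hasDerivWithinAt_comp (hx : IsSolution f g u p T x) {η : X → Y}
    (hη : Differentiable ℝ η) {t : ℝ} (ht : t ∈ Ico 0 T) :
    HasDerivWithinAt (fun s => η (x s))
      (lieD f η (x t) + lieG g η (x t) (u (x t))) (Ici 0) t := by
  simpa [lieD, lieG, Function.comp_def] using
    (hη (x t)).hasFDerivAt.comp_hasDerivWithinAt t (hx.2 t ht)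

lemma exists_isSolution [CompleteSpace X] (hloop : LocallyLipschitz fun z => f z + g z (u z))
    (p : X) : ∃ T > 0, ∃ x, IsSolution f g u p T x := by
  set F : X → X := fun z => f z + g z (u z)
  obtain ⟨K, s, hs, hlip⟩ := hloop p
  obtain ⟨a, ha : 0 < a, has⟩ := Metric.nhds_basis_closedBall.mem_iff.mp hs
  set L : ℝ := K * a + ‖F p‖ + 1
  have hL : 0 < L := by positivity
  have hbound : ∀ z ∈ Metric.closedBall p a, ‖F z‖ ≤ L := fun z hz => by
    have hFz := hlip.norm_sub_le (has hz) (mem_of_mem_nhds hs)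
    have hKa : (K : ℝ) * ‖z - p‖ ≤ K * a := by
      gcongr
      exact mem_closedBall_iff_norm.mp hz
    linarith [norm_le_norm_sub_add (F z) (F p)]
  have hT : 0 < a / L := by positivity
  have hpicard : IsPicardLindelof (fun _ => F) (tmin := 0) (tmax := a / L)
      ⟨0, left_mem_Icc.mpr hT.le⟩ p (.mk a ha.le) 0 (.mk L hL.le) K := by
    refine IsPicardLindelof.of_time_independent hbound (hlip.mono has) ?_
    simp [mul_div_cancel₀ _ hL.ne', hT.le]
  obtain ⟨x, hx0, hx⟩ := hpicard.exists_eq_forall_mem_Icc_hasDerivWithinAt₀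
  refine ⟨a / L, hT, x, hx0, fun t ht =>
    (hx t (Ico_subset_Icc_self ht)).mono_of_mem_nhdsWithin ?_⟩
  exact mem_nhdsWithin.mpr ⟨Iio (a / L), isOpen_Iio, ht.2, fun s hs => ⟨hs.2, hs.1.le⟩⟩

lemma exists_isSolution_const [CompleteSpace X] (hf : LocallyLipschitz f)
    (hg : LocallyLipschitz g) (v : U) (p : X) :
    ∃ T > 0, ∃ x, IsSolution f g (fun _ => v) p T x :=
  exists_isSolution
    (hf.add ((ContinuousLinearMap.apply ℝ X v).lipschitz.locallyLipschitz.comp hg)) p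

end Solutions

section FlatResponse

variable {X U Y Z : Type*} [NormedAddCommGroup X] [NormedSpace ℝ X]
  [NormedAddCommGroup U] [NormedSpace ℝ U] [NormedAddCommGroup Y] [NormedAddCommGroup Z]
  {f : X → X} {g : X → U →L[ℝ] X} {η : X → Y} {r : ℕ}

/-- The output `η` does not see the input to order `r`: along solutions that start at the same
point, under a constant input and under the zero input, the values of `η` differ by `o(t ^ r)`.
This replaces relative degree where the iterated Lie derivatives need not exist. -/
def HasFlatResponse (f : X → X) (g : X → U →L[ℝ] X) (η : X → Y) (r : ℕ) : Prop :=
  ∀ ⦃p v T x y⦄, 0 < T → IsSolution f g (fun _ => v) p T x → IsSolution f g (fun _ => 0) p T y →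
    (fun t => η (x t) - η (y t)) =o[𝓝[≥] 0] fun t => t ^ r

lemma HasFlatResponse.mono {s : ℕ} (h : HasFlatResponse f g η s) (hrs : r ≤ s) :
    HasFlatResponse f g η r := fun p v T x y hT hx hy => by
  rcases hrs.eq_or_lt with rfl | hlt
  · exact h hT hx hy
  · exact (h hT hx hy).trans ((isLittleO_pow_pow hlt).mono nhdsWithin_le_nhds)

lemma hasFlatResponse_zero (hη : Continuous η) : HasFlatResponse f g η 0 :=
    fun p v T x y hT hx hy => by
  have hcont : ∀ {w z}, IsSolution f g w p T z → Tendsto (fun t => η (z t)) (𝓝[≥] 0) (𝓝 (η p)) :=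
    fun hz => hz.1 ▸ hη.continuousAt.tendsto.comp (hz.continuousWithinAt ⟨le_rfl, hT⟩)
  simpa [isLittleO_one_iff] using (hcont hx).sub (hcont hy)

lemma HasFlatResponse.comp {a : Y → Z} (h : HasFlatResponse f g η r) (hη : Continuous η)
    (ha : LocallyLipschitz a) : HasFlatResponse f g (a ∘ η) r :=
    fun p v T x y hT hx hy => by
  have hcont : ∀ {w z}, IsSolution f g w p T z → ContinuousWithinAt (fun t => η (z t)) (Ici 0) 0 :=
    fun hz => hη.continuousAt.comp_continuousWithinAt (hz.continuousWithinAt ⟨le_rfl, hT⟩)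
  obtain ⟨L, hL⟩ := eventually_norm_comp_sub_le ha (hcont hx) (hcont hy) (by simp [hx.1, hy.1])
  exact (IsBigO.of_bound (L : ℝ) hL).trans_isLittleO (h hT hx hy)

variable [NormedSpace ℝ Y]

lemma HasFlatResponse.succ (hη : Differentiable ℝ η) (hinput : ∀ x, lieG g η x = 0)
    (h : HasFlatResponse f g (lieD f η) r) : HasFlatResponse f g η (r + 1) :=
    fun p v T x y hT hx hy => by
  refine isLittleO_pow_succ_of_norm_deriv_le (L := 0)
    (e' := fun t => lieD f η (x t) - lieD f η (y t)) (by simp [hx.1, hy.1]) ?_ ?_ (h hT hx hy)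
  · filter_upwards [Ico_mem_nhdsGE hT] with t ht
    simpa [hinput] using (hx.hasDerivWithinAt_comp hη ht).fun_sub (hy.hasDerivWithinAt_comp hη ht)
  · simp

lemma lieD_iterate_succ (f : X → X) (η : X → Y) (i : ℕ) :
    (lieD f)^[i + 1] η = lieD f ((lieD f)^[i] η) :=
  Function.iterate_succ_apply' _ _ _

lemma hasFlatResponse_of_iterate {k : ℕ} (hη : ∀ i < k, Differentiable ℝ ((lieD f)^[i] η))
    (hinput : ∀ i < k, ∀ x, lieG g ((lieD f)^[i] η) x = 0)
    (h : HasFlatResponse f g ((lieD f)^[k] η) r) : HasFlatResponse f g η (r + k) := by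
  induction k generalizing r with
  | zero => exact h
  | succ k ih =>
    rw [lieD_iterate_succ] at h
    rw [Nat.add_succ, ← Nat.succ_add]
    exact ih (fun i hi => hη i (by omega)) (fun i hi => hinput i (by omega))
      (h.succ (hη k k.lt_succ_self) (hinput k k.lt_succ_self))

/-- The output `η` has relative degree at least `r` for `x' = f x + g x u`: the derivatives
`L_f^i η`, `i < r`, exist and are `C¹`, and `L_g L_f^i η = 0` for `i ≤ r - 2`. Unlike for relative
degree `r`, nothing is required of `L_g L_f^(r - 1) η`. -/
def HasRelDegreeAtLeast (f : X → X) (g : X → U →L[ℝ] X) (η : X → Y) (r : ℕ) : Prop :=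
  0 < r ∧ (∀ i < r, ContDiff ℝ 1 ((lieD f)^[i] η)) ∧
    ∀ x i, i + 2 ≤ r → lieG g ((lieD f)^[i] η) x = 0

lemma HasRelDegreeAtLeast.hasFlatResponse (h : HasRelDegreeAtLeast f g η r) :
    HasFlatResponse f g η (r - 1) := by
  obtain ⟨hr, hsmooth, hinput⟩ := h
  simpa using hasFlatResponse_of_iterate (k := r - 1)
    (fun i hi => (hsmooth i (by omega)).differentiable one_ne_zero)
    (fun i hi x => hinput x i (by omega))
    (hasFlatResponse_zero (hsmooth (r - 1) (by omega)).continuous)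

end FlatResponse

section Cascade

variable {E Ec U Y Z : Type*} [NormedAddCommGroup E] [NormedSpace ℝ E]
  [NormedAddCommGroup Ec] [NormedAddCommGroup U] [NormedSpace ℝ U]
  [NormedAddCommGroup Y] [NormedAddCommGroup Z] [NormedSpace ℝ Z]
  {f : E → E} {g : E → U →L[ℝ] E} {fc : Ec → Ec} {hc : Ec → U}

lemma locallyLipschitz_drift_add_input (hf : LocallyLipschitz f) (hg : LocallyLipschitz g) :
    LocallyLipschitz fun q : E × U => f q.1 + g q.1 q.2 := by
  have hfst : LocallyLipschitz (Prod.fst : E × U → E) := LipschitzWith.prod_fst.locallyLipschitz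
  have hsnd : LocallyLipschitz (Prod.snd : E × U → U) := LipschitzWith.prod_snd.locallyLipschitz
  have happly : LocallyLipschitz fun q : (U →L[ℝ] E) × U => q.1 q.2 :=
    isBoundedBilinearMap_apply.contDiff.locallyLipschitz
  exact (hf.comp hfst).add (happly.comp ((hg.comp hfst).prodMk hsnd))

lemma locallyLipschitz_cascadeDrift (hf : LocallyLipschitz f) (hg : LocallyLipschitz g)
    (hfc : LocallyLipschitz fc) (hhc : LocallyLipschitz hc) :
    LocallyLipschitz (cascadeDrift f g fc hc) := by
  have hfst : LocallyLipschitz (Prod.fst : E × Ec → E) := LipschitzWith.prod_fst.locallyLipschitz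
  have hsnd : LocallyLipschitz (Prod.snd : E × Ec → Ec) := LipschitzWith.prod_snd.locallyLipschitz
  exact ((locallyLipschitz_drift_add_input hf hg).comp (hfst.prodMk (hhc.comp hsnd))).prodMk
    (hfc.comp hsnd)

variable [NormedSpace ℝ Ec] {gc : Ec → U →L[ℝ] Ec}
  {p : E × Ec} {T : ℝ} {x : ℝ → E × Ec} {u : E × Ec → U} {r : ℕ}

lemma locallyLipschitz_cascadeInput (hgc : LocallyLipschitz gc) :
    LocallyLipschitz (cascadeInput E gc) :=
  (ContinuousLinearMap.compL ℝ U Ec (E × Ec) (.inr ℝ E Ec)).lipschitz.locallyLipschitz.comp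
    (hgc.comp LipschitzWith.prod_snd.locallyLipschitz)

lemma IsSolution.cascade_fst (hx : IsSolution (cascadeDrift f g fc hc) (cascadeInput E gc) u p T x)
    {t : ℝ} (ht : t ∈ Ico 0 T) :
    HasDerivWithinAt (fun s => (x s).1) (f (x t).1 + g (x t).1 (hc (x t).2)) (Ici 0) t := by
  simpa [cascadeDrift, cascadeInput, Function.comp_def] using
    (hasFDerivAt_fst (p := x t)).comp_hasDerivWithinAt t (hx.2 t ht)

lemma IsSolution.cascade_snd {v : U}
    (hx : IsSolution (cascadeDrift f g fc hc) (cascadeInput E gc) (fun _ => v) p T x) :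
    IsSolution fc gc (fun _ => v) p.2 T (fun t => (x t).2) := by
  refine ⟨by simp [hx.1], fun t ht => ?_⟩
  simpa [cascadeDrift, cascadeInput, Function.comp_def] using
    (hasFDerivAt_snd (p := x t)).comp_hasDerivWithinAt t (hx.2 t ht)

lemma HasFlatResponse.cascade_snd {η : Ec → Y} (h : HasFlatResponse fc gc η r) :
    HasFlatResponse (cascadeDrift f g fc hc) (cascadeInput E gc) (η ∘ Prod.snd) r :=
  fun _ _ _ _ _ hT hx hy => h hT hx.cascade_snd hy.cascade_snd

lemma HasFlatResponse.cascade_fst (hf : LocallyLipschitz f) (hg : LocallyLipschitz g)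
    (hhc : Continuous hc) (h : HasFlatResponse fc gc hc r) :
    HasFlatResponse (cascadeDrift f g fc hc) (cascadeInput E gc) Prod.fst (r + 1) :=
    fun p v T x y hT hx hy => by
  have hcont : ∀ {w z}, IsSolution (cascadeDrift f g fc hc) (cascadeInput E gc) w p T z →
      ContinuousWithinAt (fun t => ((z t).1, hc (z t).2)) (Ici 0) 0 := fun hz =>
    (continuous_fst.prodMk (hhc.comp continuous_snd)).continuousAt.comp_continuousWithinAt
      (hz.continuousWithinAt ⟨le_rfl, hT⟩)
  obtain ⟨L, hL⟩ := eventually_norm_comp_sub_le (locallyLipschitz_drift_add_input hf hg)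
    (hcont hx) (hcont hy) (by simp [hx.1, hy.1])
  refine isLittleO_pow_succ_of_norm_deriv_le (L := L) (by simp [hx.1, hy.1])
    (by filter_upwards [Ico_mem_nhdsGE hT] with t ht
        using (hx.cascade_fst ht).fun_sub (hy.cascade_fst ht)) ?_
    ((h hT hx.cascade_snd hy.cascade_snd).const_smul_left (L : ℝ))
  filter_upwards [hL] with t ht
  calc _ ≤ L * max ‖(x t).1 - (y t).1‖ ‖hc (x t).2 - hc (y t).2‖ := ht
    _ ≤ L * (‖(x t).1 - (y t).1‖ + ‖hc (x t).2 - hc (y t).2‖) := by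
      gcongr
      exact max_le_add_of_nonneg (norm_nonneg _) (norm_nonneg _)
    _ = _ := by simp [norm_smul, mul_add]

lemma hasFDerivAt_comp_fst {η : E → Z} (hη : Differentiable ℝ η) (p : E × Ec) :
    HasFDerivAt (η ∘ Prod.fst) ((fderiv ℝ η p.1).comp (.fst ℝ E Ec)) p :=
  (hη p.1).hasFDerivAt.comp p hasFDerivAt_fst

lemma lieD_cascadeDrift_comp_fst {η : E → Z} (hη : Differentiable ℝ η)
    (hinput : ∀ x, lieG g η x = 0) :
    lieD (cascadeDrift f g fc hc) (η ∘ Prod.fst) = lieD f η ∘ Prod.fst := by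
  funext p
  have hg : fderiv ℝ η p.1 (g p.1 (hc p.2)) = 0 := DFunLike.congr_fun (hinput p.1) (hc p.2)
  simp [lieD, (hasFDerivAt_comp_fst hη p).fderiv, cascadeDrift, hg]

lemma lieG_cascadeInput_comp_fst {η : E → Z} (hη : Differentiable ℝ η) (p : E × Ec) :
    lieG (cascadeInput E gc) (η ∘ Prod.fst) p = 0 := by
  ext v
  simp [lieG, (hasFDerivAt_comp_fst hη p).fderiv, cascadeInput]

lemma HasRelDegreeAtLeast.hasFlatResponse_cascade_fst {η : E → Z} {d : ℕ}
    (hf : LocallyLipschitz f) (hg : LocallyLipschitz g) (hhc : Continuous hc)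
    (hη : HasRelDegreeAtLeast f g η d) (h : HasFlatResponse fc gc hc r) :
    HasFlatResponse (cascadeDrift f g fc hc) (cascadeInput E gc) (η ∘ Prod.fst) (r + d) := by
  obtain ⟨hd, hsmooth, hinput⟩ := hη
  have hdiff : ∀ i < d, Differentiable ℝ ((lieD f)^[i] η) :=
    fun i hi => (hsmooth i hi).differentiable one_ne_zero
  have hiterate : ∀ i < d, (lieD (cascadeDrift f g fc hc))^[i] (η ∘ Prod.fst) =
      (lieD f)^[i] η ∘ Prod.fst := fun i hi => by
    induction i with
    | zero => rfl
    | succ i ih =>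
      rw [lieD_iterate_succ, ih (by omega), lieD_iterate_succ,
        lieD_cascadeDrift_comp_fst (hdiff i (by omega)) (fun x => hinput x i (by omega))]
  obtain ⟨k, rfl⟩ : ∃ k, d = k + 1 := ⟨d - 1, by omega⟩
  rw [← Nat.succ_add_eq_add_succ]
  refine hasFlatResponse_of_iterate (fun i hi => ?_) (fun i hi p => ?_) ?_
  · rw [hiterate i (by omega)]
    exact (hdiff i (by omega)).comp differentiable_fst
  · rw [hiterate i (by omega)]
    exact lieG_cascadeInput_comp_fst (hdiff i (by omega)) p
  · rw [hiterate k k.lt_succ_self]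
    exact (h.cascade_fst hf hg hhc).comp continuous_fst (hsmooth k k.lt_succ_self).locallyLipschitz

lemma hasFlatResponse_cascadeConstraint {ι ι' : Type*} {h : ι → E → ℝ} {φ : ι' → U → ℝ}
    {d : ι → ℕ} {dc ζ : ℕ} (hf : LocallyLipschitz f) (hg : LocallyLipschitz g)
    (hA1 : ∀ j, HasRelDegreeAtLeast f g (h j) (d j)) (hC1 : HasRelDegreeAtLeast fc gc hc dc)
    (hC2 : ∀ κ, HasRelDegreeAtLeast fc gc (φ κ ∘ hc) ζ) (j : ι ⊕ ι') :
    HasFlatResponse (cascadeDrift f g fc hc) (cascadeInput E gc) (cascadeConstraint h φ hc j)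
      (cascadeDegree ι' d dc ζ j - 1) := by
  rcases j with j | κ
  · refine ((hA1 j).hasFlatResponse_cascade_fst hf hg (hC1.2.1 0 hC1.1).continuous
      hC1.hasFlatResponse).mono (le_of_eq ?_)
    have := hC1.1
    simp only [cascadeDegree, Sum.elim_inl]
    omega
  · exact (hC2 κ).hasFlatResponse.cascade_snd

end Cascade

section BSeq

variable {X U : Type*} [NormedAddCommGroup X] [NormedSpace ℝ X]
  [NormedAddCommGroup U] [NormedSpace ℝ U]
  {f : X → X} {g : X → U →L[ℝ] X} {u : X → U} {η : X → ℝ} {a : ℕ → ℝ → ℝ} {r i : ℕ}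
  {p : X} {T : ℝ} {x : ℝ → X}

lemma IsSolution.hasDerivWithinAt_bSeq (hx : IsSolution f g u p T x)
    (hb : Differentiable ℝ (bSeq f a η i)) (hinput : ∀ z, lieG g (bSeq f a η i) z = 0)
    {t : ℝ} (ht : t ∈ Ico 0 T) :
    HasDerivWithinAt (fun s => bSeq f a η i (x s))
      (bSeq f a η (i + 1) (x t) - a i (bSeq f a η i (x t))) (Ici 0) t := by
  simpa [bSeq, hinput] using hx.hasDerivWithinAt_comp hb ht

lemma lieG_bSeq_eq_zero [CompleteSpace X] (hf : LocallyLipschitz f) (hg : LocallyLipschitz g)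
    (hflat : HasFlatResponse f g η r) (ha : ∀ k, k + 2 ≤ r → LocallyLipschitz (a k))
    (hb : ∀ k < r, Differentiable ℝ (bSeq f a η k)) (hi : i < r) (p : X) :
    lieG g (bSeq f a η i) p = 0 := by
  induction i using Nat.strong_induction_on generalizing p with
  | _ i ih =>
    ext v
    obtain ⟨Tx, hTx, x, hx⟩ := exists_isSolution_const hf hg v p
    obtain ⟨Ty, hTy, y, hy⟩ := exists_isSolution_const hf hg 0 p
    have hT : 0 < min Tx Ty := lt_min hTx hTy
    replace hx := hx.mono (min_le_left Tx Ty)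
    replace hy := hy.mono (min_le_right Tx Ty)
    have hchain : ∀ {w z}, IsSolution f g w p (min Tx Ty) z → ∀ k < i, ∀ᶠ t in 𝓝[≥] 0,
        HasDerivWithinAt (fun s => bSeq f a η k (z s))
          (bSeq f a η (k + 1) (z t) - a k (bSeq f a η k (z t))) (Ici 0) t := fun hz k hk => by
      filter_upwards [Ico_mem_nhdsGE hT] with t ht
      exact hz.hasDerivWithinAt_bSeq (hb k (hk.trans hi)) (ih k hk (hk.trans hi)) ht
    have htop : HasDerivWithinAt (fun t => bSeq f a η i (x t) - bSeq f a η i (y t))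
        (lieG g (bSeq f a η i) p v) (Ici 0) 0 := by
      simpa [hx.1, hy.1] using (hx.hasDerivWithinAt_comp (hb i hi) ⟨le_rfl, hT⟩).fun_sub
        (hy.hasDerivWithinAt_comp (hb i hi) ⟨le_rfl, hT⟩)
    exact eq_zero_of_chain_sub_isLittleO (fun k hk => ha k (by omega))
      (fun k _ => by simp [hx.1, hy.1]) (hchain hx) (hchain hy) htop
      ((hflat.mono hi) hT hx hy)

end BSeq

section Invariance

variable {X U : Type*} [NormedAddCommGroup X] [NormedSpace ℝ X]
  [NormedAddCommGroup U] [NormedSpace ℝ U]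
  {f : X → X} {g : X → U →L[ℝ] X} {u : X → U} {p : X} {T : ℝ} {x : ℝ → X}

lemma exists_last_nonneg {y : ℝ → ℝ} {s t : ℝ} (hst : s ≤ t) (hy : ContinuousOn y (Icc s t))
    (hs : 0 ≤ y s) (ht : y t < 0) : ∃ τ ∈ Ico s t, 0 ≤ y τ ∧ ∀ r ∈ Ioc τ t, y r < 0 := by
  have hcompact : IsCompact (Icc s t ∩ y ⁻¹' Ici 0) :=
    isCompact_Icc.of_isClosed_subset (hy.preimage_isClosed_of_isClosed isClosed_Icc isClosed_Ici)
      inter_subset_left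
  obtain ⟨τ, ⟨hτ, hyτ⟩, hlast⟩ := hcompact.exists_isGreatest ⟨s, left_mem_Icc.mpr hst, hs⟩
  have hτt : τ < t := hτ.2.lt_of_ne fun h => ht.not_ge (h ▸ hyτ)
  refine ⟨τ, ⟨hτ.1, hτt⟩, hyτ, fun r hr => not_le.mp fun hyr => ?_⟩
  exact hr.1.not_ge (hlast ⟨⟨hτ.1.trans hr.1.le, hr.2⟩, hyr⟩)

lemma nonneg_of_hasDerivWithinAt_nonneg_of_neg {y y' : ℝ → ℝ}
    (hy : ∀ t ∈ Ico 0 T, HasDerivWithinAt y (y' t) (Ici 0) t) (h0 : 0 ≤ y 0)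
    (hy' : ∀ t ∈ Ico 0 T, y t < 0 → 0 ≤ y' t) : ∀ t ∈ Ico 0 T, 0 ≤ y t := by
  intro t ht
  by_contra! hneg
  have hsub : Icc 0 t ⊆ Ico 0 T := fun s hs => ⟨hs.1, hs.2.trans_lt ht.2⟩
  have hcont : ContinuousOn y (Icc 0 t) := fun s hs =>
    (hy s (hsub hs)).continuousWithinAt.mono Icc_subset_Ici_self
  obtain ⟨τ, hτ, hyτ, hlast⟩ := exists_last_nonneg ht.1 hcont h0 hneg
  have hmem : ∀ {s}, s ∈ Ioo τ t → s ∈ Ico 0 T := fun hs => hsub ⟨hτ.1.trans hs.1.le, hs.2.le⟩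
  obtain ⟨s, hs, hslope⟩ := exists_hasDerivAt_eq_slope y y' hτ.2
    (hcont.mono (Icc_subset_Icc_left hτ.1)) fun s hs =>
      (hy s (hmem hs)).hasDerivAt (Ici_mem_nhds (hτ.1.trans_lt hs.1))
  have hslope_neg : y' s < 0 :=
    hslope ▸ div_neg_of_neg_of_pos (by linarith) (sub_pos.mpr hτ.2)
  exact hslope_neg.not_ge (hy' s (hmem hs) (hlast s ⟨hs.1, hs.2.le⟩))

lemma IsSolution.nonneg_of_pos_on_frontier (hx : IsSolution f g u p T x) {η : X → ℝ}
    (hη : Differentiable ℝ η)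
    (hpos : ∀ z ∈ frontier {z | 0 ≤ η z}, 0 < lieD f η z + lieG g η z (u z)) (h0 : 0 ≤ η p) :
    ∀ t ∈ Ico 0 T, 0 ≤ η (x t) := by
  intro t ht
  by_contra! hneg
  have hcont : ContinuousOn x (Icc 0 t) := fun s hs =>
    (hx.continuousWithinAt ⟨hs.1, hs.2.trans_lt ht.2⟩).mono Icc_subset_Ici_self
  obtain ⟨τ, hτ, hητ, hlast⟩ := exists_last_nonneg (y := fun s => η (x s)) ht.1
    (hη.continuous.comp_continuousOn hcont) (by rwa [hx.1]) hneg
  have hτT : τ ∈ Ico 0 T := ⟨hτ.1, hτ.2.trans ht.2⟩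
  have hright : Ioi τ ⊆ Ici 0 := fun s hs => hτ.1.trans (le_of_lt hs)
  have hafter : ∀ᶠ s in 𝓝[>] τ, η (x s) < 0 := by
    filter_upwards [Ioc_mem_nhdsGT hτ.2] with s hs using hlast s hs
  have hnotint : x τ ∉ interior {z | 0 ≤ η z} := fun hint => by
    have hnonneg := ((hx.continuousWithinAt hτT).mono hright).eventually
      (isOpen_interior.mem_nhds hint)
    obtain ⟨s, hs, hs'⟩ := (hafter.and hnonneg).exists
    exact hs.not_ge (interior_subset (s := {z | 0 ≤ η z}) hs')
  have hslope := hasDerivWithinAt_iff_tendsto_slope' self_notMem_Ioi |>.mp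
    ((hx.hasDerivWithinAt_comp hη hτT).mono hright)
  obtain ⟨s, hs, hslope_pos, hτs⟩ := (hafter.and ((hslope.eventually_const_lt
    (hpos _ ⟨subset_closure hητ, hnotint⟩)).and self_mem_nhdsWithin)).exists
  rw [slope_def_field, div_pos_iff_of_pos_right (sub_pos.mpr hτs)] at hslope_pos
  linarith

lemma exists_locallyLipschitz_pos [FiniteDimensional ℝ X] {K : Set X} (hK : IsClosed K)
    {c : X → ℝ} {A : X → U →L[ℝ] ℝ} (hc : Continuous c) (hA : Continuous A)
    (hcA : ∀ z ∈ K, c z ≤ 0 → A z ≠ 0) :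
    ∃ u : X → U, LocallyLipschitz u ∧ ∀ z ∈ K, 0 < c z + A z (u z) := by
  have hconvex : ∀ z, Convex ℝ {w : U | z ∈ K → 0 < c z + A z w} := fun z => by
    by_cases hz : z ∈ K
    · simpa [hz, neg_lt_iff_pos_add'] using
        convex_halfSpace_gt (A z).toLinearMap.isLinear (-c z)
    · simpa [hz] using convex_univ
  have hlocal : ∀ z, ∃ w, ∀ᶠ z' in 𝓝 z, z' ∈ K → 0 < c z' + A z' w := fun z => by
    by_cases hz : z ∈ K
    · obtain ⟨w, hw⟩ : ∃ w, 0 < c z + A z w := by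
        rcases lt_or_ge 0 (c z) with hcz | hcz
        · exact ⟨0, by simpa using hcz⟩
        · obtain ⟨w, hw : A z w ≠ 0⟩ := DFunLike.ne_iff.mp (hcA z hz hcz)
          exact ⟨((1 - c z) / A z w) • w, by simp [hw]⟩
      have hcont : Continuous fun z' => c z' + A z' w := hc.add (hA.clm_apply continuous_const)
      exact ⟨w, (hcont.continuousAt.eventually_const_lt hw).mono fun _ h _ => h⟩
    · refine ⟨0, ?_⟩
      filter_upwards [hK.isOpen_compl.mem_nhds hz] with z' hz' hz'' using absurd hz'' hz'
  obtain ⟨u, hu⟩ :=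
    exists_contMDiffMap_forall_mem_convex_of_local_const (n := 1) 𝓘(ℝ, X) hconvex hlocal
  exact ⟨u, u.contMDiff.contDiff.locallyLipschitz, fun z hz => hu z hz⟩

lemma softmin_le {ι : Type*} [Fintype ι] {ρ : ℝ} (hρ : 0 < ρ) (z : ι → ℝ) (j : ι) :
    softmin ρ z ≤ z j := by
  have hterm : Real.exp (-ρ * z j) ≤ ∑ i, Real.exp (-ρ * z i) :=
    Finset.single_le_sum (f := fun i => Real.exp (-ρ * z i)) (fun i _ => (Real.exp_pos _).le)
      (Finset.mem_univ j)
  have hlog : -ρ * z j ≤ Real.log (∑ i, Real.exp (-ρ * z i)) :=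
    (Real.le_log_iff_exp_le ((Real.exp_pos _).trans_le hterm)).mpr hterm
  calc softmin ρ z ≤ -(1 / ρ) * (-ρ * z j) :=
        mul_le_mul_of_nonpos_left hlog (by simpa using hρ.le)
    _ = z j := by field_simp

variable {ι : Type*} [Fintype ι] {h : ι → X → ℝ} {d : ι → ℕ} {α : ι → ℕ → ℝ → ℝ} {ρ : ℝ}

lemma bSeq_top_nonneg_of_mem_setH (hρ : 0 < ρ) {z : X} (hz : z ∈ setH f h d α ρ) (j : ι) :
    0 ≤ bSeq f (α j) (h j) (d j - 1) z :=
  le_trans (a := (0 : ℝ)) hz (softmin_le hρ _ j)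

lemma mem_setS_iff (hρ : 0 < ρ) {z : X} :
    z ∈ setS f h d α ρ ↔
      z ∈ setH f h d α ρ ∧ ∀ j i, i + 2 ≤ d j → 0 ≤ bSeq f (α j) (h j) i z := by
  refine and_congr_right fun hz => ?_
  simp only [setC, mem_iInter, setCj]
  refine forall_congr' fun j => ?_
  split_ifs with hj
  · have htop := bSeq_top_nonneg_of_mem_setH hρ hz j
    rw [hj] at htop
    exact ⟨fun _ i hi => by omega, fun _ => htop⟩
  · rfl

lemma IsSolution.bSeq_nonneg (hx : IsSolution f g u p T x) {a : ℕ → ℝ → ℝ} {η : X → ℝ} {N : ℕ}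
    (ha : ∀ k < N, ∀ z < 0, a k z ≤ 0) (hb : ∀ k < N, Differentiable ℝ (bSeq f a η k))
    (hinput : ∀ k < N, ∀ z, lieG g (bSeq f a η k) z = 0) (h0 : ∀ k < N, 0 ≤ bSeq f a η k p)
    (htop : ∀ t ∈ Ico 0 T, 0 ≤ bSeq f a η N (x t)) {k : ℕ} (hk : k ≤ N) :
    ∀ t ∈ Ico 0 T, 0 ≤ bSeq f a η k (x t) := by
  induction hk using Nat.decreasingInduction with
  | self => exact htop
  | of_succ k hk ih =>
    exact nonneg_of_hasDerivWithinAt_nonneg_of_neg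
      (fun t ht => hx.hasDerivWithinAt_bSeq (hb k hk) (hinput k hk) ht)
      (by simpa [hx.1] using h0 k hk)
      fun t ht hneg => sub_nonneg.mpr ((ha k hk _ hneg).trans (ih t ht))

theorem controlForwardInvariant_setS [FiniteDimensional ℝ X] (hf : Continuous f)
    (hg : Continuous g) (hρ : 0 < ρ) (hα : ∀ j i, i + 2 ≤ d j → ∀ z < 0, α j i z ≤ 0)
    (hb : ∀ j i, i + 2 ≤ d j → Differentiable ℝ (bSeq f (α j) (h j) i))
    (hh : ContDiff ℝ 1 (composite f h d α ρ))
    (hB : ∀ z ∈ setB f h d α ρ, lieG g (composite f h d α ρ) z ≠ 0)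
    (hinput : ∀ j i, i + 2 ≤ d j → ∀ z, lieG g (bSeq f (α j) (h j) i) z = 0) :
    ControlForwardInvariant f g (setS f h d α ρ) := by
  have hderiv : Continuous (fderiv ℝ (composite f h d α ρ)) := hh.continuous_fderiv one_ne_zero
  obtain ⟨u, hu, hpos⟩ := exists_locallyLipschitz_pos
    (isClosed_frontier (s := setH f h d α ρ)) (hderiv.clm_apply hf) (hderiv.clm_comp hg)
    fun z hz hz' => hB z ⟨hz, hz'⟩
  refine ⟨u, hu, fun p hp T x hx t ht => ?_⟩
  rw [mem_setS_iff hρ] at hp ⊢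
  have hH : ∀ s ∈ Ico 0 T, x s ∈ setH f h d α ρ :=
    hx.nonneg_of_pos_on_frontier (hh.differentiable one_ne_zero) hpos hp.1
  refine ⟨hH t ht, fun j i hi => ?_⟩
  exact hx.bSeq_nonneg (N := d j - 1) (fun k hk => hα j k (by omega))
    (fun k hk => hb j k (by omega)) (fun k hk => hinput j k (by omega))
    (fun k hk => hp.2 j k (by omega))
    (fun s hs => bSeq_top_nonneg_of_mem_setH hρ (hH s hs) j) (by omega) t ht

end Invariance

section Main

variable {E Ec U ι ι' : Type*} [NormedAddCommGroup E] [NormedSpace ℝ E] [FiniteDimensional ℝ E]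
  [NormedAddCommGroup Ec] [NormedSpace ℝ Ec] [FiniteDimensional ℝ Ec]
  [NormedAddCommGroup U] [NormedSpace ℝ U] [Fintype ι] [Fintype ι']
  {f : E → E} {g : E → U →L[ℝ] E} {fc : Ec → Ec} {gc : Ec → U →L[ℝ] Ec} {hc : Ec → U}
  {h : ι → E → ℝ} {φ : ι' → U → ℝ} {d : ι → ℕ} {dc ζ : ℕ} {α : ι ⊕ ι' → ℕ → ℝ → ℝ} {ρ : ℝ}

theorem mainTheorem5_general (hf : LocallyLipschitz f) (hg : LocallyLipschitz g)
    (hfc : LocallyLipschitz fc) (hgc : LocallyLipschitz gc) (hhc : LocallyLipschitz hc)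
    (hA1 : ∀ j, HasRelDegreeAtLeast f g (h j) (d j)) (hC1 : HasRelDegreeAtLeast fc gc hc dc)
    (hC2 : ∀ κ, HasRelDegreeAtLeast fc gc (φ κ ∘ hc) ζ)
    (hα : ∀ j i, i + 2 ≤ cascadeDegree ι' d dc ζ j →
      LocallyLipschitz (α j i) ∧ ∀ z < 0, α j i z ≤ 0)
    (hρ : 0 < ρ)
    (hb : ∀ j i, i + 2 ≤ cascadeDegree ι' d dc ζ j →
      Differentiable ℝ (bSeq (cascadeDrift f g fc hc) (α j) (cascadeConstraint h φ hc j) i))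
    (hh : ContDiff ℝ 1 (composite (cascadeDrift f g fc hc) (cascadeConstraint h φ hc)
      (cascadeDegree ι' d dc ζ) α ρ))
    (hB : ∀ p ∈ setB (cascadeDrift f g fc hc) (cascadeConstraint h φ hc)
        (cascadeDegree ι' d dc ζ) α ρ,
      lieG (cascadeInput E gc) (composite (cascadeDrift f g fc hc) (cascadeConstraint h φ hc)
        (cascadeDegree ι' d dc ζ) α ρ) p ≠ 0) :
    ControlForwardInvariant (cascadeDrift f g fc hc) (cascadeInput E gc)
      (setS (cascadeDrift f g fc hc) (cascadeConstraint h φ hc) (cascadeDegree ι' d dc ζ) α ρ) := by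
  have : CompleteSpace E := FiniteDimensional.complete ℝ E
  have : CompleteSpace Ec := FiniteDimensional.complete ℝ Ec
  have hdrift := locallyLipschitz_cascadeDrift hf hg hfc hhc
  have hinput := locallyLipschitz_cascadeInput (E := E) hgc
  refine controlForwardInvariant_setS hdrift.continuous hinput.continuous hρ
    (fun j i hi => (hα j i hi).2) hb hh hB fun j i hi =>
      lieG_bSeq_eq_zero hdrift hinput (hasFlatResponse_cascadeConstraint hf hg hA1 hC1 hC2 j)
        (fun k hk => (hα j k (by omega)).1) (fun k hk => hb j k (by omega)) (by omega)

end Main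

end SoftMinCBF

theorem mainTheorem5 {n nc m ℓ ℓu : ℕ}
    -- the plant and its constraint functions
    (f : EuclideanSpace ℝ (Fin n) → EuclideanSpace ℝ (Fin n))
    (g : EuclideanSpace ℝ (Fin n) → EuclideanSpace ℝ (Fin m) →L[ℝ] EuclideanSpace ℝ (Fin n))
    (hf : LocallyLipschitz f) (hg : LocallyLipschitz g)
    (h : Fin ℓ → EuclideanSpace ℝ (Fin n) → ℝ) (d : Fin ℓ → ℕ)
    (hA1 : SoftMinCBF.CondA1 f g h d)
    -- the control dynamics and the input constraint functions
    (fc : EuclideanSpace ℝ (Fin nc) → EuclideanSpace ℝ (Fin nc))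
    (gc : EuclideanSpace ℝ (Fin nc) → EuclideanSpace ℝ (Fin m) →L[ℝ] EuclideanSpace ℝ (Fin nc))
    (hc : EuclideanSpace ℝ (Fin nc) → EuclideanSpace ℝ (Fin m))
    (hfc : LocallyLipschitz fc) (hgc : LocallyLipschitz gc) (hhc : LocallyLipschitz hc)
    (φ : Fin ℓu → EuclideanSpace ℝ (Fin m) → ℝ) (hφ : ∀ κ, ContDiff ℝ 1 (φ κ))
    (dc ζ : ℕ)
    (hC1 : SoftMinCBF.CondC1 fc gc hc dc) (hC2 : SoftMinCBF.CondC2 fc gc hc φ ζ)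
    -- the class-K functions and the parameter of the soft minimum
    (α : Fin ℓ ⊕ Fin ℓu → ℕ → ℝ → ℝ)
    (hα : ∀ j i, i + 2 ≤ SoftMinCBF.cascadeDegree (Fin ℓu) d dc ζ j →
      SoftMinCBF.IsExtendedClassK (α j i) ∧ LocallyLipschitz (α j i))
    (ρ : ℝ) (hρ : 0 < ρ)
    -- the derivatives of the cascade functions that occur exist and are continuous
    (hb : ∀ j i, i + 2 ≤ SoftMinCBF.cascadeDegree (Fin ℓu) d dc ζ j →
      ContDiff ℝ 1 (SoftMinCBF.bSeq (SoftMinCBF.cascadeDrift f g fc hc) (α j)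
        (SoftMinCBF.cascadeConstraint h φ hc j) i))
    (hh : ContDiff ℝ 1 (SoftMinCBF.composite (SoftMinCBF.cascadeDrift f g fc hc)
      (SoftMinCBF.cascadeConstraint h φ hc) (SoftMinCBF.cascadeDegree (Fin ℓu) d dc ζ) α ρ))
    -- the derivative of the composite function is locally Lipschitz on its superlevel set
    (hLip : LocallyLipschitzOn
      (SoftMinCBF.setH (SoftMinCBF.cascadeDrift f g fc hc)
        (SoftMinCBF.cascadeConstraint h φ hc) (SoftMinCBF.cascadeDegree (Fin ℓu) d dc ζ) α ρ)
      (fderiv ℝ (SoftMinCBF.composite (SoftMinCBF.cascadeDrift f g fc hc)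
        (SoftMinCBF.cascadeConstraint h φ hc) (SoftMinCBF.cascadeDegree (Fin ℓu) d dc ζ) α ρ)))
    (hB : ∀ p ∈ SoftMinCBF.setB (SoftMinCBF.cascadeDrift f g fc hc)
        (SoftMinCBF.cascadeConstraint h φ hc) (SoftMinCBF.cascadeDegree (Fin ℓu) d dc ζ) α ρ,
      SoftMinCBF.lieG (SoftMinCBF.cascadeInput (EuclideanSpace ℝ (Fin n)) gc)
        (SoftMinCBF.composite (SoftMinCBF.cascadeDrift f g fc hc)
          (SoftMinCBF.cascadeConstraint h φ hc) (SoftMinCBF.cascadeDegree (Fin ℓu) d dc ζ) α ρ)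
        p ≠ 0) :
    SoftMinCBF.ControlForwardInvariant (SoftMinCBF.cascadeDrift f g fc hc)
      (SoftMinCBF.cascadeInput (EuclideanSpace ℝ (Fin n)) gc)
      (SoftMinCBF.setS (SoftMinCBF.cascadeDrift f g fc hc)
        (SoftMinCBF.cascadeConstraint h φ hc) (SoftMinCBF.cascadeDegree (Fin ℓu) d dc ζ) α ρ) := by
  have hα' : ∀ j i, i + 2 ≤ SoftMinCBF.cascadeDegree (Fin ℓu) d dc ζ j →
      LocallyLipschitz (α j i) ∧ ∀ z < 0, α j i z ≤ 0 := fun j i hi =>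
    ⟨(hα j i hi).2, fun z hz => (hα j i hi).1.2.2 ▸ ((hα j i hi).1.2.1 hz).le⟩
  exact SoftMinCBF.mainTheorem5_general hf hg hfc hgc hhc
    (fun j => ⟨(hA1 j).1, (hA1 j).2.1, (hA1 j).2.2.1⟩) ⟨hC1.1, hC1.2.1, hC1.2.2.1⟩
    (fun κ => ⟨hC2.1, (hC2.2 κ).1, (hC2.2 κ).2.1⟩) hα' hρ
    (fun j i hi => (hb j i hi).differentiable one_ne_zero) hh hB
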